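/- For every real $B>0$ there is a real constant $c$, depending only on $B$, with the following property. Let $D\ge 1$ be an integer, let $x\ge D$ be real, let $k\ge 1$, let $\chi_1,\dots,\chi_k$ be distinct Dirichlet characters modulo $D$, and let $a_p\in\mathbb{C}$ be arbitrary for each prime $p$. Then, writing $s=\sigma+it$ with $\sigma,t$ real, and with $p$ denoting primes, the maxima below are attained and $$\sum_{j=1}^k \max_{y\le x}\ \max_{\sigma\ge 1,\ |t|\le D^B}\Bigl|\sum_{D<p\le y} a_p\,\chi_j(p)\,p^{-s}\Bigr|^2 \le \bigl(4L+(k-1)c\bigr)\sum_{D<p\le x}\frac{|a_p|^2}{p},\qquad L=\sum_{D<p\le x}\frac1p .$$ -/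

import Mathlib

/-- The finite set of primes `p` with `D < p ≤ y`, for a natural number `D` and a real `y`. -/
noncomputable def primesIoc (D : ℕ) (y : ℝ) : Finset ℕ :=
  (Finset.Ioc D ⌊y⌋₊).filter Nat.Prime

theorem mem_primesIoc {D : ℕ} {y : ℝ} {p : ℕ} :
    p ∈ primesIoc D y ↔ p.Prime ∧ D < p ∧ (p : ℝ) ≤ y := by
  simp only [primesIoc, Finset.mem_filter, Finset.mem_Ioc]
  constructor
  · rintro ⟨⟨h1, h2⟩, hp⟩
    exact ⟨hp, h1, (Nat.le_floor_iff' hp.ne_zero).1 h2⟩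
  · rintro ⟨hp, h1, h2⟩
    exact ⟨⟨h1, (Nat.le_floor_iff' hp.ne_zero).2 h2⟩, hp⟩

/-- The twisted prime sum `∑_{D < p ≤ y} a_p χ(p) p^{-s}`. -/
noncomputable def primeSum {D : ℕ} (a : ℕ → ℂ) (χ : DirichletCharacter ℂ D) (y : ℝ) (s : ℂ) : ℂ :=
  ∑ p ∈ primesIoc D y, a p * χ (p : ZMod D) * (p : ℂ) ^ (-s)

/-- The region `σ ≥ 1`, `|t| ≤ T` of complex numbers `s = σ + it`. -/
def halfStrip (T : ℝ) : Set ℂ :=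
  {s | 1 ≤ s.re ∧ |s.im| ≤ T}

/-!
By duality, the left side is governed by the quadratic form `∑_p p |∑_j z_j φ_j(p)|²`, where
`φ_j(p) = χ_j(p) p^{-s_j}` for `D < p ≤ y_j` and the `y_j`, `s_j` are chosen to attain the maxima.
Its diagonal entries are at most `L`. The off-diagonal ones are sums `∑ χ(p) p^{-s}` over primes
`D < p ≤ y`, with `χ = χ_j χ_l⁻¹` non-principal, `Re s ≥ 1` and `|Im s| ≤ 2 D^B`. Their real
parts are bounded above, but not below. For nonnegative `z_j` this already gives the bound
`L + (k - 1) C`, and splitting complex `z_j` into four nonnegative families costs the factor `4`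
(`sum_mul_norm_sum_mul_sq_le`, `sum_norm_sum_mul_sq_le_of_dual`).

The one-sided bound is `DirichletCharacter.exists_re_sum_primesIoc_le`. Truncating a prime sum at
`y` amounts, up to `O(1)`, to shifting the full series to `s + δ / log y`
(`exists_norm_sum_primesIoc_sub_tsum_le`), and that series has real part `log |L| + O(1)`. So the sum
over `D < p ≤ y` has real part `log |L(s₁, χ)| - log |L(s₂, χ)| + O(1)`, with `s₁ = s + δ / log y`
to the left of `s₂ = s + δ / log D`. All zeros of `L` have real part at most `1`, so each is at
least as close to `s₁` as to `s₂`, and the corresponding factors of `L` can only make the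
difference smaller. What remains after dividing out the zeros near the centre of a fixed disc is
a zero-free function bounded by `D ^ O(1)` times its central value; by Borel–Carathéodory its
logarithm varies at rate `O(log D)`, hence by `O(1)` over the distance `|s₁ - s₂| ≤ 1 / log D`
(`norm_le_exp_mul_norm_of_zeros_closer`). The continuation of `L` to the left of `1`, with the
bound `|s| D / Re s`, comes from partial summation (`DirichletCharacter.mellinL`).
-/

/-! ### Comparing values of a holomorphic function by dividing out zeros -/

open Metric in
/-- The zeros of an analytic function in a smaller disc can be divided out. -/
theorem AnalyticOnNhd.exists_eq_prod_mul_of_closedBall {f : ℂ → ℂ} {c : ℂ} {R ρ : ℝ} (hρ : 0 < ρ)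
    (hρR : ρ < R) (hf : AnalyticOnNhd ℂ f (closedBall c R)) (hc : f c ≠ 0) :
    ∃ (Z : Finset ℂ) (n : ℂ → ℕ) (g : ℂ → ℂ),
      (∀ u ∈ Z, f u = 0 ∧ dist u c ≤ ρ) ∧ AnalyticOnNhd ℂ g (closedBall c R) ∧
      (∀ s ∈ ball c R, f s = (∏ u ∈ Z, (s - u) ^ n u) * g s) ∧
      ∀ s, dist s c ≤ ρ → g s ≠ 0 := by
  classical
  have hR : 0 < R := hρ.trans hρR
  set U := closedBall c R with hU
  have hcU : c ∈ U := mem_closedBall_self hR.le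
  have hm : MeromorphicOn f U := hf.meromorphicOn
  have hc0 : meromorphicOrderAt f c ≠ ⊤ := by
    rw [(hf c hcU).meromorphicOrderAt_eq, (hf c hcU).analyticOrderAt_eq_zero.2 hc]
    simp
  have htop : ∀ u : U, meromorphicOrderAt f u ≠ ⊤ := fun u =>
    hm.meromorphicOrderAt_ne_top_of_isPreconnected
      (convex_closedBall c R).isPreconnected hcU u.2 hc0
  have hfin : (MeromorphicOn.divisor f U).support.Finite :=
    (MeromorphicOn.divisor f U).finiteSupport (isCompact_closedBall c R)
  obtain ⟨g, hg, hg0, hfg⟩ := MeromorphicOn.extract_zeros_poles hm htop hfin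
  have hd0 : ∀ u, 0 ≤ MeromorphicOn.divisor f U u := fun u =>
    MeromorphicOn.AnalyticOnNhd.divisor_nonneg hf u
  set d := MeromorphicOn.divisor f U with hd
  set n : ℂ → ℕ := fun u => (d u).toNat with hn
  set Z := hfin.toFinset with hZ
  have hprod : ∀ s, (∏ᶠ u, ((· - u) ^ d u : ℂ → ℂ)) s = ∏ u ∈ Z, (s - u) ^ n u := by
    intro s
    rw [finprod_eq_prod_of_mulSupport_subset (s := Z), Finset.prod_apply]
    · refine Finset.prod_congr rfl fun u _ => ?_
      rw [Pi.pow_apply, ← zpow_natCast, hn]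
      congr 1
      exact (Int.toNat_of_nonneg (hd0 u)).symm
    · rw [Function.FactorizedRational.mulSupport, hZ]
      simp
  have heq : ∀ s ∈ ball c R, f s = (∏ u ∈ Z, (s - u) ^ n u) * g s := by
    intro s hs
    have hsU : s ∈ U := ball_subset_closedBall hs
    have h1 : ∀ᶠ z in nhdsWithin s {s}ᶜ, f z = (∏ u ∈ Z, (z - u) ^ n u) * g z := by
      have h2 := (mem_codiscreteWithin.1 hfg) s hsU
      rw [Filter.disjoint_principal_right] at h2
      have h3 : U ∈ nhdsWithin s {s}ᶜ :=
        mem_nhdsWithin_of_mem_nhds (Filter.mem_of_superset (isOpen_ball.mem_nhds hs)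
          ball_subset_closedBall)
      filter_upwards [h2, h3] with z hz hzU
      by_contra hne
      refine hz ⟨hzU, fun h => hne ?_⟩
      have h' : f z = _ := h
      rw [h', Pi.smul_apply', hprod, smul_eq_mul]
    have hcont : ContinuousAt f s := (hf s hsU).continuousAt
    have hcont' : ContinuousAt (fun z => (∏ u ∈ Z, (z - u) ^ n u) * g z) s := by
      refine ContinuousAt.mul ?_ (hg s hsU).continuousAt
      fun_prop
    exact (hcont.eventuallyEq_nhds_iff_eventuallyEq_nhdsNE hcont').1 h1 |>.eq_of_nhds
  refine ⟨Z.filter (fun u => dist u c ≤ ρ), n,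
    fun s => (∏ u ∈ Z.filter (fun u => ¬ dist u c ≤ ρ), (s - u) ^ n u) * g s, ?_, ?_, ?_, ?_⟩
  · intro u hu
    obtain ⟨huZ, hud⟩ := Finset.mem_filter.1 hu
    refine ⟨?_, hud⟩
    rw [heq u (mem_ball.2 (hud.trans_lt hρR)), Finset.prod_eq_zero huZ, zero_mul]
    rw [sub_self, zero_pow]
    have : d u ≠ 0 := by simpa [hZ] using huZ
    have := hd0 u
    simp only [hn]
    omega
  · intro s hs
    refine AnalyticAt.mul ?_ (hg s hs)
    fun_prop
  · intro s hs
    rw [heq s hs, ← mul_assoc, Finset.prod_filter_mul_prod_filter_not]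
  · intro s hs
    refine mul_ne_zero (Finset.prod_ne_zero_iff.2 fun u hu => ?_)
      (hg0 ⟨s, mem_closedBall.2 (hs.trans hρR.le)⟩)
    refine pow_ne_zero _ (sub_ne_zero.2 ?_)
    rintro rfl
    exact (Finset.mem_filter.1 hu).2 hs

open Metric in
/-- A zero-free holomorphic function on a disc, normalized at the centre, is an exponential. -/
theorem DifferentiableOn.exists_exp_eq_of_ball {g : ℂ → ℂ} {c : ℂ} {ρ : ℝ} (hρ : 0 < ρ)
    (hg : DifferentiableOn ℂ g (ball c ρ)) (h0 : ∀ s ∈ ball c ρ, g s ≠ 0) :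
    ∃ h : ℂ → ℂ, DifferentiableOn ℂ h (ball c ρ) ∧ h c = 0 ∧
      ∀ s ∈ ball c ρ, g s = g c * Complex.exp (h s) := by
  have hq : DifferentiableOn ℂ (fun s => _root_.deriv g s / g s) (ball c ρ) :=
    (hg.deriv isOpen_ball).div hg h0
  obtain ⟨h, hc, hh⟩ := hq.isExactOn_ball.with_val_at c 0
  refine ⟨h, fun s hs => (hh s hs).differentiableAt.differentiableWithinAt, hc, fun s hs => ?_⟩
  have hder : ∀ z ∈ ball c ρ, HasDerivAt (fun z => g z * Complex.exp (-h z)) 0 z := by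
    intro z hz
    have h1 := ((hg z hz).differentiableAt (isOpen_ball.mem_nhds hz)).hasDerivAt
    have h2 : HasDerivAt (fun z => g z * Complex.exp (-h z)) _ z :=
      h1.fun_mul (hh z hz).fun_neg.cexp
    refine h2.congr_deriv ?_
    have := h0 z hz
    field_simp
    ring
  have hconst := isOpen_ball.is_const_of_deriv_eq_zero (convex_ball c ρ).isPreconnected
    (fun z hz => (hder z hz).differentiableAt.differentiableWithinAt)
    (fun z hz => (hder z hz).deriv) hs (mem_ball_self hρ)
  simp only [hc, neg_zero, Complex.exp_zero, mul_one] at hconst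
  rw [← hconst, mul_assoc, ← Complex.exp_add, neg_add_cancel, Complex.exp_zero, mul_one]

open Metric in
/-- A zero-free holomorphic function that exceeds its central value by a factor at most `e ^ M`
has logarithm varying at rate `O(M / ρ)` in the inner half of the disc: this is the
Borel–Carathéodory theorem together with Cauchy's estimate. -/
theorem norm_le_exp_mul_norm_of_ne_zero {g : ℂ → ℂ} {c : ℂ} {ρ M : ℝ} (hρ : 0 < ρ) (hM : 0 < M)
    (hg : DifferentiableOn ℂ g (ball c ρ)) (h0 : ∀ s ∈ ball c ρ, g s ≠ 0)
    (hb : ∀ s ∈ ball c ρ, ‖g s‖ ≤ Real.exp M * ‖g c‖) {s₁ s₂ : ℂ}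
    (h1 : s₁ ∈ closedBall c (ρ / 2)) (h2 : s₂ ∈ closedBall c (ρ / 2)) :
    ‖g s₁‖ ≤ Real.exp (24 * M / ρ * ‖s₁ - s₂‖) * ‖g s₂‖ := by
  obtain ⟨h, hd, hc, hexp⟩ := hg.exists_exp_eq_of_ball hρ h0
  have hgc : 0 < ‖g c‖ := norm_pos_iff.2 (h0 c (mem_ball_self hρ))
  have hre : ∀ s ∈ ball c ρ, (h s).re ≤ M := by
    intro s hs
    have := hb s hs
    rw [hexp s hs, norm_mul, Complex.norm_exp, mul_comm] at this
    exact Real.exp_le_exp.1 (le_of_mul_le_mul_right this hgc)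
  have hbound : ∀ s, dist s c ≤ 3 * ρ / 4 → ‖h s‖ ≤ 6 * M := by
    intro s hs
    have hmap : ∀ z ∈ ball (0 : ℂ) ρ, c + z ∈ ball c ρ := fun z hz => by
      simpa [dist_eq_norm] using hz
    have hz : s - c ∈ ball (0 : ℂ) ρ := by
      rw [mem_ball_zero_iff, ← dist_eq_norm]; linarith
    have := Complex.borelCaratheodory_zero (f := fun z => h (c + z)) hM
      (hd.comp (by fun_prop) hmap) (fun z hz => hre _ (hmap z hz)) hρ hz (by simpa using hc)
    simp only [add_sub_cancel] at this
    refine this.trans ?_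
    rw [← dist_eq_norm]
    rw [div_le_iff₀ (by linarith)]
    nlinarith
  have hderiv : ∀ s ∈ closedBall c (ρ / 2), ‖deriv h s‖ ≤ 24 * M / ρ := by
    intro s hs
    rw [mem_closedBall] at hs
    have hsub : closedBall s (ρ / 4) ⊆ ball c ρ := fun z hz => by
      rw [mem_closedBall] at hz
      rw [mem_ball]
      linarith [dist_triangle z s c]
    have := Complex.norm_deriv_le_of_forall_mem_sphere_norm_le (f := h) (c := s) (R := ρ / 4)
      (C := 6 * M) (by positivity) ?_ ?_
    · refine this.trans (le_of_eq ?_)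
      field_simp
      norm_num
    · refine DifferentiableOn.diffContOnCl ?_
      rw [closure_ball s (by positivity)]
      exact hd.mono hsub
    · intro z hz
      refine hbound z ?_
      rw [mem_sphere] at hz
      linarith [dist_triangle z s c]
  have hin : closedBall c (ρ / 2) ⊆ ball c ρ := closedBall_subset_ball (by linarith)
  have hmv := (convex_closedBall c (ρ / 2)).norm_image_sub_le_of_norm_deriv_le
    (fun z hz => (hd z (hin hz)).differentiableAt (isOpen_ball.mem_nhds (hin hz))) hderiv h2 h1
  have hre' : (h s₁).re ≤ 24 * M / ρ * ‖s₁ - s₂‖ + (h s₂).re := by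
    have := (Complex.re_le_norm (h s₁ - h s₂)).trans hmv
    rw [Complex.sub_re] at this
    linarith
  rw [hexp s₁ (hin h1), hexp s₂ (hin h2), norm_mul, norm_mul, Complex.norm_exp, Complex.norm_exp]
  calc ‖g c‖ * Real.exp (h s₁).re
      ≤ ‖g c‖ * Real.exp (24 * M / ρ * ‖s₁ - s₂‖ + (h s₂).re) := by gcongr
    _ = _ := by rw [Real.exp_add]; ring

open Metric in
/-- If every zero of `f` is at least as close to `s₁` as to `s₂`, then `f` can be larger at `s₁`
than at `s₂` only by a controlled factor. The zeros near the centre are divided out; on a circle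
of radius at least `2 * ρ` each factor `s - u` is no smaller than at the centre, so that the
quotient inherits the bound on `f`. -/
theorem norm_le_exp_mul_norm_of_zeros_closer {f : ℂ → ℂ} {c : ℂ} {ρ R M : ℝ} (hρ : 0 < ρ)
    (hρR : 2 * ρ < R) (hM : 0 < M) (hf : AnalyticOnNhd ℂ f (closedBall c R)) (hc : f c ≠ 0)
    (hb : ∀ s ∈ ball c R, ‖f s‖ ≤ Real.exp M * ‖f c‖) {s₁ s₂ : ℂ}
    (h1 : s₁ ∈ closedBall c (ρ / 2)) (h2 : s₂ ∈ closedBall c (ρ / 2))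
    (hz : ∀ u ∈ ball c R, f u = 0 → ‖s₁ - u‖ ≤ ‖s₂ - u‖) :
    ‖f s₁‖ ≤ Real.exp (24 * M / ρ * ‖s₁ - s₂‖) * ‖f s₂‖ := by
  obtain ⟨Z, n, g, hZ, hg, hfac, hg0⟩ := hf.exists_eq_prod_mul_of_closedBall hρ (by linarith) hc
  have hcR : c ∈ ball c R := mem_ball_self (by linarith)
  have hPc : 0 < ‖∏ u ∈ Z, (c - u) ^ n u‖ := by
    rw [norm_pos_iff]
    intro h
    rw [hfac c hcR, h, zero_mul] at hc
    exact hc rfl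
  have hin : closedBall c (2 * ρ) ⊆ ball c R := closedBall_subset_ball hρR
  have hgb : ∀ s ∈ ball c ρ, ‖g s‖ ≤ Real.exp M * ‖g c‖ := by
    intro s hs
    refine Complex.norm_le_of_forall_mem_frontier_norm_le (U := ball c (2 * ρ)) isBounded_ball
      ?_ ?_ (subset_closure (ball_subset_ball (by linarith) hs))
    · refine DifferentiableOn.diffContOnCl ?_
      rw [closure_ball c (by positivity)]
      exact hg.differentiableOn.mono (hin.trans ball_subset_closedBall)
    · intro z hzf
      rw [frontier_ball c (by positivity), mem_sphere] at hzf
      have hzR : z ∈ ball c R := hin (mem_closedBall.2 hzf.le)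
      have hP : ‖∏ u ∈ Z, (c - u) ^ n u‖ ≤ ‖∏ u ∈ Z, (z - u) ^ n u‖ := by
        rw [norm_prod, norm_prod]
        refine Finset.prod_le_prod (fun u _ => norm_nonneg _) fun u hu => ?_
        rw [norm_pow, norm_pow]
        gcongr ?_ ^ _
        have hud := (hZ u hu).2
        rw [← dist_eq_norm, ← dist_eq_norm, dist_comm c u]
        linarith [dist_triangle z u c]
      have hfz := hb z hzR
      rw [hfac z hzR, hfac c hcR, norm_mul, norm_mul] at hfz
      have hle : ‖∏ u ∈ Z, (c - u) ^ n u‖ * ‖g z‖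
          ≤ ‖∏ u ∈ Z, (c - u) ^ n u‖ * (Real.exp M * ‖g c‖) := by
        calc _ ≤ ‖∏ u ∈ Z, (z - u) ^ n u‖ * ‖g z‖ := by gcongr
          _ ≤ _ := hfz
          _ = _ := by ring
      exact le_of_mul_le_mul_left hle hPc
  have hmain := norm_le_exp_mul_norm_of_ne_zero hρ hM
    (hg.differentiableOn.mono (ball_subset_closedBall.trans (closedBall_subset_closedBall
      (by linarith)))) (fun s hs => hg0 s (mem_ball.1 hs).le) hgb h1 h2
  have hsub : closedBall c (ρ / 2) ⊆ ball c R := closedBall_subset_ball (by linarith)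
  have hP : ‖∏ u ∈ Z, (s₁ - u) ^ n u‖ ≤ ‖∏ u ∈ Z, (s₂ - u) ^ n u‖ := by
    rw [norm_prod, norm_prod]
    refine Finset.prod_le_prod (fun u _ => norm_nonneg _) fun u hu => ?_
    rw [norm_pow, norm_pow]
    gcongr ?_ ^ _
    exact hz u (mem_ball.2 (by linarith [(hZ u hu).2])) (hZ u hu).1
  rw [hfac s₁ (hsub h1), hfac s₂ (hsub h2), norm_mul, norm_mul]
  calc _ ≤ ‖∏ u ∈ Z, (s₂ - u) ^ n u‖ * (Real.exp (24 * M / ρ * ‖s₁ - s₂‖) * ‖g s₂‖) := by gcongr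
    _ = _ := by ring

/-! ### Dirichlet series over primes -/

open ArithmeticFunction in
/-- The Dirichlet series of `log p` over primes has at most a simple pole at `1`. -/
theorem exists_tsum_primes_log_mul_rpow_le :
    ∃ C : ℝ, 0 ≤ C ∧ ∀ ε : ℝ, 0 < ε → ε ≤ 1 →
      Summable (fun p : Nat.Primes => Real.log p * (p : ℝ) ^ (-(1 + ε))) ∧
        ε * ∑' p : Nat.Primes, Real.log p * (p : ℝ) ^ (-(1 + ε)) ≤ C := by
  -- Modulo `1` the residue class is everything, and the auxiliary function is the negative logarithmic
  -- derivative of `ζ` with its pole at `1` removed.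
  have hcont : ContinuousOn (fun x : ℝ => vonMangoldt.LFunctionResidueClassAux (1 : ZMod 1) x)
      (Set.Icc 1 2) :=
    (vonMangoldt.continuousOn_LFunctionResidueClassAux (1 : ZMod 1)).comp
      Complex.continuous_ofReal.continuousOn fun x hx => by simpa using hx.1
  obtain ⟨C, hC⟩ := isCompact_Icc.exists_bound_of_continuousOn hcont
  refine ⟨|C| + 1, by positivity, fun ε hε hε1 => ?_⟩
  have hx : 1 < ((1 + ε : ℝ) : ℂ).re := by rw [Complex.ofReal_re]; linarith
  have hterm : ∀ n : ℕ, LSeries.term (fun n => (vonMangoldt n : ℂ)) ((1 + ε : ℝ) : ℂ) n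
      = ((vonMangoldt n * (n : ℝ) ^ (-(1 + ε)) : ℝ) : ℂ) := by
    intro n
    rcases eq_or_ne n 0 with rfl | hn
    · simp
    · rw [LSeries.term_of_ne_zero hn, Real.rpow_neg n.cast_nonneg]
      push_cast [Complex.ofReal_cpow (Nat.cast_nonneg n)]
      rw [div_eq_mul_inv]
  have hsumC := LSeriesSummable_vonMangoldt hx
  have hsum : Summable fun n : ℕ => vonMangoldt n * (n : ℝ) ^ (-(1 + ε)) := by
    rw [LSeriesSummable, funext hterm] at hsumC
    exact Complex.summable_ofReal.1 hsumC
  have hnn : ∀ n : ℕ, 0 ≤ vonMangoldt n * (n : ℝ) ^ (-(1 + ε)) := fun n =>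
    mul_nonneg vonMangoldt_nonneg (Real.rpow_nonneg n.cast_nonneg _)
  have hcongr : (fun p : Nat.Primes => Real.log p * (p : ℝ) ^ (-(1 + ε)))
      = fun p : Nat.Primes => vonMangoldt p * ((p : ℕ) : ℝ) ^ (-(1 + ε)) := by
    funext p
    rw [vonMangoldt_apply_prime p.2]
  rw [hcongr]
  refine ⟨hsum.subtype {p : ℕ | p.Prime}, ?_⟩
  have hle := Summable.tsum_subtype_le _ {p : ℕ | p.Prime} hnn hsum
  have htot : ∑' n : ℕ, vonMangoldt n * (n : ℝ) ^ (-(1 + ε)) ≤ |C| + 1 / ε := by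
    have hL := vonMangoldt.eqOn_LFunctionResidueClassAux (a := (1 : ZMod 1)) isUnit_one
      (x := ((1 + ε : ℝ) : ℂ)) hx
    have hres : (fun n : ℕ => ((vonMangoldt.residueClass (1 : ZMod 1) n : ℝ) : ℂ))
        = fun n => (vonMangoldt n : ℂ) := by
      funext n
      rw [vonMangoldt.residueClass, Set.indicator_of_mem]
      exact Subsingleton.elim _ _
    simp only [hres] at hL
    have hval : LSeries (fun n => (vonMangoldt n : ℂ)) ((1 + ε : ℝ) : ℂ)
        = ((∑' n : ℕ, vonMangoldt n * (n : ℝ) ^ (-(1 + ε)) : ℝ) : ℂ) := by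
      rw [LSeries, Complex.ofReal_tsum]
      exact tsum_congr hterm
    have hb := hC (1 + ε) ⟨by linarith, by linarith⟩
    rw [hL, hval] at hb
    simp only [Nat.totient_one, Nat.cast_one, inv_one] at hb
    have hcast : ((1 + ε : ℝ) : ℂ) - 1 = (ε : ℂ) := by push_cast; ring
    rw [hcast, ← Complex.ofReal_one, ← Complex.ofReal_div, ← Complex.ofReal_sub,
      Complex.norm_real, Real.norm_eq_abs] at hb
    linarith [le_abs_self ((∑' n : ℕ, vonMangoldt n * (n : ℝ) ^ (-(1 + ε))) - 1 / ε),
      le_abs_self C]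
  calc ε * _ ≤ ε * (|C| + 1 / ε) := by
        gcongr
        exact hle.trans htot
    _ = ε * |C| + 1 := by field_simp
    _ ≤ |C| + 1 := by
        gcongr
        exact mul_le_of_le_one_left (abs_nonneg C) hε1

theorem Nat.Primes.summable_mul_cpow_neg {f : ℕ → ℂ} (hf : ∀ n, ‖f n‖ ≤ 1) {s : ℂ}
    (hs : 1 < s.re) : Summable fun p : Nat.Primes => f p * (p : ℂ) ^ (-s) := by
  refine Summable.of_norm_bounded (Nat.Primes.summable_rpow.2 (neg_lt_neg hs)) fun p => ?_
  rw [norm_mul, Complex.norm_natCast_cpow_of_pos p.2.pos, Complex.neg_re]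
  exact mul_le_of_le_one_left (by positivity) (hf p)

theorem hasSum_ite_primesIoc (y : ℝ) (F : ℕ → ℂ) :
    HasSum (fun p : Nat.Primes => if ((p : ℕ) : ℝ) ≤ y then F p else 0)
      (∑ p ∈ primesIoc 0 y, F p) := by
  let T : Finset Nat.Primes := (primesIoc 0 y).subtype Nat.Prime
  have hT : ∀ p : Nat.Primes, p ∈ T ↔ ((p : ℕ) : ℝ) ≤ y := fun p =>
    Finset.mem_subtype.trans (mem_primesIoc.trans ⟨fun h => h.2.2, fun h => ⟨p.2, p.2.pos, h⟩⟩)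
  have h : ∑ p ∈ primesIoc 0 y, F p = ∑ p ∈ T, if ((p : ℕ) : ℝ) ≤ y then F p else 0 := by
    refine (Finset.sum_subtype_of_mem (p := Nat.Prime) F
      (fun p hp => (mem_primesIoc.1 hp).1)).symm.trans ?_
    exact Finset.sum_congr rfl fun p hp => (if_pos ((hT p).1 hp)).symm
  rw [h]
  exact hasSum_sum_of_ne_finset_zero fun p hp => if_neg fun hy => hp ((hT p).2 hy)

/-- Termwise comparison of a sum over primes truncated at `y` with the full series shifted to the
right by `δ / log y`. -/
theorem norm_ite_sub_cpow_shift_le {δ y : ℝ} (hδ : 0 < δ) (hδ1 : δ ≤ 1) (hy0 : 0 < y)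
    (hy : 1 ≤ Real.log y)
    {s : ℂ} (hs : 1 ≤ s.re) {z : ℂ} (hz : ‖z‖ ≤ 1) {p : ℕ} (hp : p.Prime) :
    ‖(if (p : ℝ) ≤ y then z * (p : ℂ) ^ (-s) else 0)
        - z * (p : ℂ) ^ (-(s + (δ / Real.log y : ℝ)))‖
      ≤ 3 / δ * (δ / Real.log y * (Real.log p * (p : ℝ) ^ (-(1 + δ / Real.log y)))) := by
  have hp0 : (0 : ℝ) < p := by exact_mod_cast hp.pos
  have hp1 : (1 : ℝ) ≤ p := by exact_mod_cast hp.one_lt.le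
  have hly : 0 < Real.log y := by linarith
  set ε := δ / Real.log y with hε
  have hε0 : 0 < ε := by positivity
  have hlp : 0 ≤ Real.log p := Real.log_nonneg hp1
  have hpC : (p : ℂ) ≠ 0 := by exact_mod_cast hp.ne_zero
  have hσ : (p : ℝ) ^ (-s.re) ≤ (p : ℝ) ^ (-1 : ℝ) :=
    Real.rpow_le_rpow_of_exponent_le hp1 (by linarith)
  split_ifs with hpy
  -- For `p ≤ y` the shift changes the term by at most `ε log p / p`, and `p ^ ε ≤ e ^ δ`.
  · have hsplit : z * (p : ℂ) ^ (-s) - z * (p : ℂ) ^ (-(s + (ε : ℝ)))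
        = z * (p : ℂ) ^ (-s) * ((1 - (p : ℝ) ^ (-ε) : ℝ) : ℂ) := by
      rw [neg_add, Complex.cpow_add _ _ hpC]
      push_cast [Complex.ofReal_cpow hp0.le]
      ring
    have hle1 : (p : ℝ) ^ (-ε) ≤ 1 := Real.rpow_le_one_of_one_le_of_nonpos hp1 (by linarith)
    have hlin : 1 - (p : ℝ) ^ (-ε) ≤ ε * Real.log p := by
      have := Real.add_one_le_exp (Real.log p * -ε)
      rw [Real.rpow_def_of_pos hp0]
      linarith
    have hpe : (p : ℝ) ^ ε ≤ 3 / δ := by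
      calc (p : ℝ) ^ ε ≤ y ^ ε := Real.rpow_le_rpow hp0.le hpy hε0.le
        _ = Real.exp δ := by
            rw [Real.rpow_def_of_pos hy0, hε, mul_div_cancel₀ _ hly.ne']
        _ ≤ Real.exp 1 := Real.exp_le_exp.2 hδ1
        _ ≤ 3 := Real.exp_one_lt_three.le
        _ ≤ 3 / δ := by rw [le_div_iff₀ hδ]; linarith
    rw [hsplit, norm_mul, norm_mul, Complex.norm_natCast_cpow_of_pos hp.pos, Complex.neg_re,
      Complex.norm_real, Real.norm_of_nonneg (by linarith)]
    calc ‖z‖ * (p : ℝ) ^ (-s.re) * (1 - (p : ℝ) ^ (-ε))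
        ≤ 1 * (p : ℝ) ^ (-1 : ℝ) * (ε * Real.log p) := by gcongr
      _ = (p : ℝ) ^ ε * (ε * (Real.log p * (p : ℝ) ^ (-(1 + ε)))) := by
          rw [neg_add, Real.rpow_add hp0, Real.rpow_neg hp0.le ε]
          have : (p : ℝ) ^ ε ≠ 0 := (Real.rpow_pos_of_pos hp0 ε).ne'
          field_simp
      _ ≤ _ := by gcongr
  -- For `p > y` the factor `log p / log y ≥ 1` is available.
  · rw [zero_sub, norm_neg, norm_mul, Complex.norm_natCast_cpow_of_pos hp.pos]
    have hre : (-(s + (ε : ℝ))).re ≤ -(1 + ε) := by simp; linarith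
    have hlog : Real.log y ≤ Real.log p := Real.log_le_log hy0 (not_le.1 hpy).le
    calc ‖z‖ * (p : ℝ) ^ (-(s + (ε : ℝ))).re ≤ 1 * (p : ℝ) ^ (-(1 + ε)) := by
          gcongr
      _ = δ⁻¹ * (ε * (Real.log y * (p : ℝ) ^ (-(1 + ε)))) := by
          rw [hε]; field_simp
      _ ≤ 3 / δ * (ε * (Real.log p * (p : ℝ) ^ (-(1 + ε)))) := by
          gcongr
          rw [inv_eq_one_div]
          gcongr
          norm_num

/-- Truncating a sum over primes at `y` amounts, up to a bounded error, to shifting the full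
series to the right by a multiple of `1 / log y`. -/
theorem exists_norm_sum_primesIoc_sub_tsum_le {δ : ℝ} (hδ : 0 < δ) (hδ1 : δ ≤ 1) :
    ∃ C : ℝ, 0 ≤ C ∧ ∀ (f : ℕ → ℂ), (∀ n, ‖f n‖ ≤ 1) → ∀ y : ℝ, 0 < y → 1 ≤ Real.log y →
      ∀ s : ℂ, 1 ≤ s.re →
        ‖∑ p ∈ primesIoc 0 y, f p * (p : ℂ) ^ (-s)
          - ∑' p : Nat.Primes, f p * (p : ℂ) ^ (-(s + (δ / Real.log y : ℝ)))‖ ≤ C := by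
  obtain ⟨C, hC0, hC⟩ := exists_tsum_primes_log_mul_rpow_le
  refine ⟨3 / δ * C, by positivity, fun f hf y hy0 hy s hs => ?_⟩
  have hε0 : 0 < δ / Real.log y := by positivity
  obtain ⟨hsum, hle⟩ := hC (δ / Real.log y) hε0
    ((div_le_one (by linarith)).2 (hδ1.trans hy))
  have h1 := (hasSum_ite_primesIoc y fun p => f p * (p : ℂ) ^ (-s)).sub
    (Nat.Primes.summable_mul_cpow_neg hf (s := s + (δ / Real.log y : ℝ))
      (by rw [Complex.add_re, Complex.ofReal_re]; linarith)).hasSum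
  rw [← h1.tsum_eq]
  refine (tsum_of_norm_bounded ((hsum.mul_left (δ / Real.log y)).mul_left (3 / δ)).hasSum
    fun p => norm_ite_sub_cpow_shift_le hδ hδ1 hy0 hy hs (hf p) p.2).trans ?_
  rw [tsum_mul_left, tsum_mul_left]
  gcongr

/-- For `Re s > 1`, the prime sum of `χ` and `log |L(s, χ)|` differ by a bounded amount,
uniformly in the character. -/
theorem exists_abs_re_tsum_primes_sub_log_norm_LSeries_le :
    ∃ C : ℝ, ∀ (D : ℕ) (χ : DirichletCharacter ℂ D) (s : ℂ), 1 < s.re →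
      0 < ‖LSeries (fun n => χ n) s‖ ∧
      |(∑' p : Nat.Primes, χ p * (p : ℂ) ^ (-s)).re - Real.log ‖LSeries (fun n => χ n) s‖|
        ≤ C := by
  refine ⟨∑' p : Nat.Primes, (p : ℝ) ^ (-2 : ℝ), fun D χ s hs => ?_⟩
  have hsum := Nat.Primes.summable_mul_cpow_neg (f := fun n => χ n)
    (fun n => DirichletCharacter.norm_le_one χ _) hs
  have hexp := DirichletCharacter.LSeries_eulerProduct_exp_log χ hs
  have hlog : Real.log ‖LSeries (fun n => χ n) s‖
      = (∑' p : Nat.Primes, -Complex.log (1 - χ p * (p : ℂ) ^ (-s))).re := by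
    rw [← hexp, Complex.norm_exp, Real.log_exp]
  refine ⟨by rw [← hexp, norm_pos_iff]; exact Complex.exp_ne_zero _, ?_⟩
  rw [hlog, ← Complex.sub_re]
  refine (Complex.abs_re_le_norm _).trans ?_
  have h1 := hsum.hasSum.sub hsum.clog_one_sub.neg.hasSum
  rw [← h1.tsum_eq]
  refine tsum_of_norm_bounded (Nat.Primes.summable_rpow.2 (by norm_num)).hasSum fun p => ?_
  set z := χ p * (p : ℂ) ^ (-s) with hz
  have hp2 : (2 : ℝ) ≤ ((p : ℕ) : ℝ) := by exact_mod_cast p.2.two_le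
  have hz1 : ‖z‖ ≤ ((p : ℕ) : ℝ) ^ (-1 : ℝ) := by
    rw [hz, norm_mul, Complex.norm_natCast_cpow_of_pos p.2.pos, Complex.neg_re]
    calc _ ≤ 1 * ((p : ℕ) : ℝ) ^ (-1 : ℝ) := by
          gcongr
          · exact DirichletCharacter.norm_le_one χ _
          · linarith
      _ = _ := one_mul _
  have hz2 : ‖z‖ ≤ 1 / 2 := hz1.trans (by
    rw [Real.rpow_neg_one, inv_eq_one_div]
    gcongr)
  have h := Complex.norm_log_one_add_sub_self_le (z := -z) (by rw [norm_neg]; linarith)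
  rw [norm_neg] at h
  have heq : z - -Complex.log (1 - z) = Complex.log (1 + -z) - -z := by ring_nf
  rw [heq]
  have hinv : (1 - ‖z‖)⁻¹ ≤ 2 := by
    rw [inv_le_comm₀ (by linarith) (by norm_num)]
    linarith
  calc _ ≤ ‖z‖ ^ 2 * (1 - ‖z‖)⁻¹ / 2 := h
    _ ≤ ‖z‖ ^ 2 * 2 / 2 := by gcongr
    _ = ‖z‖ ^ 2 := by ring
    _ ≤ (((p : ℕ) : ℝ) ^ (-1 : ℝ)) ^ 2 := by gcongr
    _ = _ := by
      rw [← Real.rpow_natCast, ← Real.rpow_mul (by positivity)]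
      norm_num

/-! ### Continuation of `L(s, χ)` by partial summation -/

namespace DirichletCharacter

variable {D : ℕ} {χ : DirichletCharacter ℂ D}

/-- The partial sums `∑_{n ≤ u} χ(n)`. -/
noncomputable def partialSum (χ : DirichletCharacter ℂ D) (u : ℝ) : ℂ :=
  ∑ i ∈ Finset.Icc 1 ⌊u⌋₊, χ (i : ZMod D)

/-- The continuation of `L(s, χ)` to `Re s > 0` by partial summation, `s ∫ S(u) u^{-s-1} du`
with `S` the summatory function of `χ`. -/
noncomputable def mellinL (χ : DirichletCharacter ℂ D) (s : ℂ) : ℂ :=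
  s * mellin (partialSum χ) (-s)

theorem partialSum_eq_zero {u : ℝ} (hu : u < 1) : partialSum χ u = 0 := by
  rw [partialSum, Nat.floor_eq_zero.2 hu]
  simp

theorem mellin_partialSum_eq (s : ℂ) : mellin (partialSum χ) (-s)
    = ∫ u in Set.Ioi (1 : ℝ), partialSum χ u * (u : ℂ) ^ (-(s + 1)) := by
  rw [mellin, ← MeasureTheory.integral_Ici_eq_integral_Ioi (x := (1 : ℝ))]
  refine (MeasureTheory.setIntegral_eq_of_subset_of_forall_sdiff_eq_zero (s := Set.Ici (1 : ℝ))
    measurableSet_Ioi (Set.Ici_subset_Ioi.2 one_pos) fun u hu => ?_).trans ?_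
  · rw [partialSum_eq_zero (not_le.1 hu.2), smul_zero]
  · refine MeasureTheory.setIntegral_congr_fun measurableSet_Ici fun u _ => ?_
    simp only [smul_eq_mul]
    rw [mul_comm, show -s - 1 = -(s + 1) by ring]

variable [NeZero D]

theorem sum_range_eq_zero_of_ne_one (hχ : χ ≠ 1) : ∑ i ∈ Finset.range D, χ (i : ZMod D) = 0 := by
  rw [← MulChar.sum_eq_zero_of_ne_one hχ]
  refine Finset.sum_nbij' (fun i => (i : ZMod D)) ZMod.val ?_ ?_ ?_ ?_ ?_
  · simp
  · intro a _; exact Finset.mem_range.2 (ZMod.val_lt a)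
  · intro i hi; exact ZMod.val_cast_of_lt (Finset.mem_range.1 hi)
  · intro a _; simp
  · simp

theorem norm_sum_range_le (hχ : χ ≠ 1) (n : ℕ) :
    ‖∑ i ∈ Finset.range n, χ (i : ZMod D)‖ ≤ D := by
  have hper : ∀ q r : ℕ, ∑ i ∈ Finset.range (D * q + r), χ (i : ZMod D)
      = ∑ i ∈ Finset.range r, χ (i : ZMod D) := by
    intro q r
    induction q with
    | zero => simp
    | succ q ih =>
      rw [← ih, show D * (q + 1) + r = D + (D * q + r) by ring, Finset.sum_range_add,
        sum_range_eq_zero_of_ne_one hχ, zero_add]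
      simp
  rw [← Nat.div_add_mod n D, hper]
  refine (norm_sum_le _ _).trans ((Finset.sum_le_card_nsmul _ _ 1
    fun i _ => DirichletCharacter.norm_le_one χ _).trans ?_)
  rw [Finset.card_range, nsmul_one]
  exact_mod_cast (Nat.mod_lt n (NeZero.pos D)).le

theorem norm_sum_Icc_le (hχ : χ ≠ 1) (n : ℕ) :
    ‖∑ i ∈ Finset.Icc 1 n, χ (i : ZMod D)‖ ≤ D := by
  have hD : Nontrivial (ZMod D) := by
    rw [ZMod.nontrivial_iff]
    rintro rfl
    exact hχ (Subsingleton.elim _ _)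
  have h := norm_sum_range_le hχ (n + 1)
  rw [Finset.range_eq_Ico, Finset.sum_eq_sum_Ico_succ_bot (Nat.succ_pos n), Nat.cast_zero,
    MulChar.map_zero, zero_add] at h
  exact h

theorem mellinL_eq_LSeries (hχ : χ ≠ 1) {s : ℂ} (hs : 1 < s.re) :
    mellinL χ s = LSeries (fun n => χ n) s := by
  rw [mellinL, mellin_partialSum_eq]
  refine (LSeries_eq_mul_integral (fun n => χ n) le_rfl (by linarith)
    (LSeriesSummable_of_one_lt_re χ hs) ?_).symm
  simp only [Real.rpow_zero]
  exact Asymptotics.isBigO_iff.2 ⟨D, Filter.Eventually.of_forall fun n => by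
    simpa using norm_sum_Icc_le hχ n⟩

theorem differentiableAt_mellinL (hχ : χ ≠ 1) {s : ℂ} (hs : 0 < s.re) :
    DifferentiableAt ℂ (mellinL χ) s := by
  have hint : MeasureTheory.LocallyIntegrableOn (partialSum χ) (Set.Ioi 0) := by
    have := locallyIntegrableOn_mul_sum_Icc (c := fun n : ℕ => χ (n : ZMod D)) (m := 1)
      (le_refl (0 : ℝ)) (g := fun _ => (1 : ℂ)) (MeasureTheory.locallyIntegrableOn_const _)
    simp only [one_mul] at this
    exact this.mono_set Set.Ioi_subset_Ici_self
  have htop : partialSum χ =O[Filter.atTop] (fun x : ℝ => x ^ (-(0 : ℝ))) := by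
    simp only [neg_zero, Real.rpow_zero]
    exact Asymptotics.isBigO_iff.2 ⟨D, Filter.Eventually.of_forall fun u => by
      simpa [partialSum] using norm_sum_Icc_le hχ ⌊u⌋₊⟩
  have hbot : partialSum χ =O[nhdsWithin 0 (Set.Ioi 0)] (fun x : ℝ => x ^ (-(-s.re - 1))) := by
    refine Asymptotics.isBigO_iff.2 ⟨1, ?_⟩
    filter_upwards [mem_nhdsWithin_of_mem_nhds (Iio_mem_nhds one_pos)] with u hu
    rw [partialSum_eq_zero hu, norm_zero]
    positivity
  have h := mellin_differentiableAt_of_isBigO_rpow (s := -s) hint htop (by simpa using hs) hbot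
    (by simp)
  exact differentiableAt_id.mul (h.comp s differentiableAt_id.neg)

theorem norm_mellinL_le (hχ : χ ≠ 1) {s : ℂ} (hs : 0 < s.re) :
    ‖mellinL χ s‖ ≤ ‖s‖ * (D / s.re) := by
  rw [mellinL, norm_mul]
  gcongr
  rw [mellin_partialSum_eq]
  have hlt : -(s.re + 1) < -1 := by linarith
  calc _ ≤ ∫ u in Set.Ioi (1 : ℝ), (D : ℝ) * u ^ (-(s.re + 1)) := by
        refine MeasureTheory.norm_integral_le_of_norm_le
          ((integrableOn_Ioi_rpow_of_lt hlt one_pos).const_mul _) ?_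
        refine (MeasureTheory.ae_restrict_iff' measurableSet_Ioi).2
          (Filter.Eventually.of_forall fun u hu => ?_)
        have hu0 : (0 : ℝ) < u := one_pos.trans hu
        rw [norm_mul, Complex.norm_cpow_eq_rpow_re_of_pos hu0]
        simp only [Complex.neg_re, Complex.add_re, Complex.one_re]
        gcongr
        exact norm_sum_Icc_le hχ _
    _ = D / s.re := by
        rw [MeasureTheory.integral_const_mul, integral_Ioi_rpow_of_lt hlt one_pos, Real.one_rpow]
        rw [show -(s.re + 1) + 1 = -s.re by ring, neg_div_neg_eq]
        ring

end DirichletCharacter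

/-! ### One-sided bound for twisted sums over primes -/

namespace DirichletCharacter

/-- Moving left by `1 / log D` inside `Re s > 1` increases `log |L(s, χ)|` by at most a constant:
the zeros lie to the left, so they are closer to the left point, and `L` is bounded by a power
of `D` in a disc of fixed radius. -/
theorem exists_log_norm_LSeries_le_add {B : ℝ} (hB : 0 < B) :
    ∃ C : ℝ, 0 ≤ C ∧ ∀ (D : ℕ) [NeZero D], 1 ≤ Real.log D → ∀ χ : DirichletCharacter ℂ D, χ ≠ 1 →
      ∀ s₁ s₂ : ℂ, s₁.im = s₂.im → |s₁.im| ≤ 2 * (D : ℝ) ^ B → 1 < s₁.re → s₁.re ≤ s₂.re →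
        s₂.re ≤ 5 / 4 → s₂.re - s₁.re ≤ 1 / Real.log D →
        Real.log ‖LSeries (fun n => χ n) s₁‖ ≤ Real.log ‖LSeries (fun n => χ n) s₂‖ + C := by
  obtain ⟨C₀, hC₀⟩ := exists_abs_re_tsum_primes_sub_log_norm_LSeries_le
  set P : ℝ := ∑' p : Nat.Primes, (p : ℝ) ^ (-(9 / 8) : ℝ) with hP
  have hPs : Summable fun p : Nat.Primes => (p : ℝ) ^ (-(9 / 8) : ℝ) :=
    Nat.Primes.summable_rpow.2 (by norm_num)
  have hP0 : 0 ≤ P := tsum_nonneg fun p => by positivity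
  -- `exp (K log D)` bounds `|L| / |L(c)|` on the disc: `3` accounts for a factor `8`, `B + 1` for the
  -- power of `D`, and the rest for the lower bound at the centre `c`.
  set K : ℝ := 3 + (B + 1) + (|C₀| + P) with hK
  have hK0 : 0 < K := by positivity
  refine ⟨96 * K, by positivity, fun D _ hD χ hχ s₁ s₂ him ht h1 h12 h2 hd => ?_⟩
  have hD1 : (1 : ℝ) ≤ D := by exact_mod_cast NeZero.pos D
  have hD0 : (0 : ℝ) < D := by linarith
  have hDB : 1 ≤ (D : ℝ) ^ B := Real.one_le_rpow hD1 hB.le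
  -- The disc of radius `5 / 8` about `c` stays in `Re s ≥ 1 / 2`, and the concentric disc of radius
  -- `1 / 8` contains both points.
  set c : ℂ := ⟨9 / 8, s₁.im⟩ with hc
  have hcre : 1 < c.re := by rw [hc]; norm_num
  obtain ⟨hc0, hcl⟩ := hC₀ D χ c hcre
  -- At the centre the prime sum converges absolutely, which bounds `|L|` from below.
  have hclow : -(|C₀| + P) ≤ Real.log ‖LSeries (fun n => χ n) c‖ := by
    have hle : ‖∑' p : Nat.Primes, χ p * (p : ℂ) ^ (-c)‖ ≤ P := by
      refine tsum_of_norm_bounded hPs.hasSum fun p => ?_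
      rw [norm_mul, Complex.norm_natCast_cpow_of_pos p.2.pos, Complex.neg_re]
      exact mul_le_of_le_one_left (by positivity) (DirichletCharacter.norm_le_one χ _)
    have h3 := (abs_le.1 ((Complex.abs_re_le_norm _).trans hle)).1
    have h4 := (abs_le.1 hcl).2
    have h5 := le_abs_self C₀
    linarith
  have hball : ∀ s ∈ Metric.closedBall c (5 / 8), 1 / 2 ≤ s.re ∧ ‖s‖ ≤ 4 * (D : ℝ) ^ B := by
    intro s hs
    rw [Metric.mem_closedBall, dist_eq_norm] at hs
    have hre := (abs_le.1 ((Complex.abs_re_le_norm _).trans hs)).1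
    rw [Complex.sub_re] at hre
    have hcr : c.re = 9 / 8 := rfl
    have hcn : ‖c‖ ≤ 9 / 8 + |s₁.im| := by
      refine (Complex.norm_le_abs_re_add_abs_im c).trans (le_of_eq ?_)
      rw [hcr, abs_of_pos (by norm_num)]
    refine ⟨by linarith, ?_⟩
    linarith [norm_le_norm_sub_add s c]
  set M : ℝ := K * Real.log D with hM
  have hM0 : 0 < M := by positivity
  have hb : ∀ s ∈ Metric.ball c (5 / 8), ‖mellinL χ s‖ ≤ Real.exp M * ‖mellinL χ c‖ := by
    intro s hs
    obtain ⟨hre, hn⟩ := hball s (Metric.ball_subset_closedBall hs)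
    have hup : ‖mellinL χ s‖ ≤ 8 * (D : ℝ) ^ (B + 1) := by
      calc ‖mellinL χ s‖ ≤ ‖s‖ * (D / s.re) := norm_mellinL_le hχ (by linarith)
        _ ≤ 4 * (D : ℝ) ^ B * (D / (1 / 2)) := by gcongr
        _ = _ := by rw [Real.rpow_add hD0, Real.rpow_one]; ring
    have h8 : (8 : ℝ) ≤ Real.exp 3 := by
      have := Real.exp_one_gt_d9
      calc (8 : ℝ) = 2 ^ 3 := by norm_num
        _ ≤ Real.exp 1 ^ 3 := by gcongr; linarith
        _ = Real.exp 3 := by rw [← Real.exp_nat_mul]; norm_num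
    have hlow : Real.exp (-(|C₀| + P)) ≤ ‖mellinL χ c‖ := by
      rw [mellinL_eq_LSeries hχ hcre, ← Real.exp_log hc0]
      exact Real.exp_le_exp.2 hclow
    calc ‖mellinL χ s‖ ≤ 8 * (D : ℝ) ^ (B + 1) := hup
      _ ≤ Real.exp 3 * Real.exp (Real.log D * (B + 1)) := by
          rw [Real.rpow_def_of_pos hD0]; gcongr
      _ = Real.exp (3 + Real.log D * (B + 1) + (|C₀| + P)) * Real.exp (-(|C₀| + P)) := by
          rw [← Real.exp_add, ← Real.exp_add]; ring_nf
      _ ≤ Real.exp M * ‖mellinL χ c‖ := by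
          gcongr
          rw [hM, hK]
          have : 0 ≤ |C₀| + P := by positivity
          nlinarith
  have hmem : ∀ s : ℂ, s.im = s₁.im → 1 < s.re → s.re ≤ 5 / 4 →
      s ∈ Metric.closedBall c (1 / 4 / 2) := by
    intro s hs hs1 hs2
    have : s - c = ((s.re - 9 / 8 : ℝ) : ℂ) := by
      apply Complex.ext <;> simp [hc, hs]
    rw [Metric.mem_closedBall, dist_eq_norm, this, Complex.norm_real, Real.norm_eq_abs, abs_le]
    constructor <;> linarith
  have hmain := norm_le_exp_mul_norm_of_zeros_closer (f := mellinL χ) (c := c) (ρ := 1 / 4)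
    (R := 5 / 8) (M := M) (by norm_num) (by norm_num) hM0 ?_
    (by rw [mellinL_eq_LSeries hχ hcre]; exact norm_pos_iff.1 hc0) hb
    (hmem s₁ rfl h1 (by linarith)) (hmem s₂ him.symm (by linarith) h2) ?_
  · rw [mellinL_eq_LSeries hχ h1, mellinL_eq_LSeries hχ (by linarith)] at hmain
    have hL1 := (hC₀ D χ s₁ h1).1
    have hL2 := (hC₀ D χ s₂ (by linarith)).1
    have hlog := Real.log_le_log hL1 hmain
    rw [Real.log_mul (Real.exp_pos _).ne' hL2.ne', Real.log_exp] at hlog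
    have hdist : ‖s₁ - s₂‖ ≤ 1 / Real.log D := by
      have : s₁ - s₂ = ((s₁.re - s₂.re : ℝ) : ℂ) := by
        apply Complex.ext <;> simp [him]
      rw [this, Complex.norm_real, Real.norm_eq_abs, abs_sub_comm, abs_of_nonneg (by linarith)]
      exact hd
    have hfin : 24 * M / (1 / 4) * ‖s₁ - s₂‖ ≤ 96 * K := by
      calc 24 * M / (1 / 4) * ‖s₁ - s₂‖ ≤ 24 * M / (1 / 4) * (1 / Real.log D) := by gcongr
        _ = 96 * K := by
          rw [hM]
          have : Real.log D ≠ 0 := by linarith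
          field_simp
          norm_num
    linarith
  · intro s hs
    have hopen : IsOpen {s : ℂ | 0 < s.re} := isOpen_lt continuous_const Complex.continuous_re
    have hdiff : DifferentiableOn ℂ (mellinL χ) {s : ℂ | 0 < s.re} := fun z hz =>
      (differentiableAt_mellinL hχ hz).differentiableWithinAt
    exact hdiff.analyticAt (hopen.mem_nhds (show 0 < s.re by linarith [(hball s hs).1]))
  · intro u _ hu
    have hu1 : u.re ≤ 1 := by
      by_contra h
      rw [mellinL_eq_LSeries hχ (not_le.1 h)] at hu
      exact (norm_pos_iff.1 (hC₀ D χ u (not_le.1 h)).1) hu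
    rw [Complex.norm_def, Complex.norm_def]
    apply Real.sqrt_le_sqrt
    rw [Complex.normSq_apply, Complex.normSq_apply, Complex.sub_re, Complex.sub_im,
      Complex.sub_re, Complex.sub_im, him]
    nlinarith

/-- There is no non-principal character to a modulus below `3`; hence `log D ≥ 1` in the sequel. -/
theorem three_le_of_ne_one {D : ℕ} (hD : 1 ≤ D) {χ : DirichletCharacter ℂ D} (hχ : χ ≠ 1) :
    3 ≤ D := by
  by_contra h
  have h2 : D = 1 ∨ D = 2 := by omega
  rcases h2 with rfl | rfl
  · exact hχ (Subsingleton.elim _ _)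
  · refine hχ (MulChar.ext fun a => ?_)
    have ha : a = 1 := by
      revert a
      decide
    rw [ha, Units.val_one, map_one, map_one]

/-- For non-principal `χ` modulo `D`, sums of `χ(p) p^{-s}` over primes beyond `D` have real part
bounded above. The bound is one-sided: an exceptional zero can make such a sum very negative. -/
theorem exists_re_sum_primesIoc_le {B : ℝ} (hB : 0 < B) :
    ∃ C : ℝ, 0 ≤ C ∧ ∀ D : ℕ, 1 ≤ D → ∀ χ : DirichletCharacter ℂ D, χ ≠ 1 → ∀ (y : ℝ) (s : ℂ),
      1 ≤ s.re → |s.im| ≤ 2 * (D : ℝ) ^ B →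
        (∑ p ∈ primesIoc D y, χ (p : ZMod D) * (p : ℂ) ^ (-s)).re ≤ C := by
  obtain ⟨C₁, hC₁0, hC₁⟩ := exists_norm_sum_primesIoc_sub_tsum_le (δ := 1 / 8) (by norm_num)
    (by norm_num)
  obtain ⟨C₂, hC₂⟩ := exists_abs_re_tsum_primes_sub_log_norm_LSeries_le
  obtain ⟨C₃, hC₃0, hC₃⟩ := exists_log_norm_LSeries_le_add hB
  set P : ℝ := ∑' p : Nat.Primes, (p : ℝ) ^ (-(9 / 8) : ℝ) with hP
  have hPs : Summable fun p : Nat.Primes => (p : ℝ) ^ (-(9 / 8) : ℝ) :=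
    Nat.Primes.summable_rpow.2 (by norm_num)
  have hP0 : 0 ≤ P := tsum_nonneg fun p => by positivity
  refine ⟨2 * C₁ + 2 * |C₂| + C₃ + 2 * P, by positivity, fun D hD χ hχ y s hs ht => ?_⟩
  have hD3 : (3 : ℝ) ≤ D := by exact_mod_cast three_le_of_ne_one hD hχ
  have : NeZero D := ⟨by omega⟩
  have hlD : 1 ≤ Real.log D := by
    rw [Real.le_log_iff_exp_le (by linarith)]
    linarith [Real.exp_one_lt_three]
  rcases lt_or_ge y D with hy | hy
  · have hempty : primesIoc D y = ∅ := by
      refine Finset.eq_empty_of_forall_notMem fun p hp => ?_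
      obtain ⟨-, h1, h2⟩ := mem_primesIoc.1 hp
      have h3 : (D : ℝ) < p := by exact_mod_cast h1
      linarith
    rw [hempty, Finset.sum_empty, Complex.zero_re]
    positivity
  have hly : Real.log D ≤ Real.log y := Real.log_le_log (by linarith) hy
  have hsub : ∑ p ∈ primesIoc D y, χ (p : ZMod D) * (p : ℂ) ^ (-s)
      = ∑ p ∈ primesIoc 0 y, χ (p : ZMod D) * (p : ℂ) ^ (-s)
        - ∑ p ∈ primesIoc 0 D, χ (p : ZMod D) * (p : ℂ) ^ (-s) := by
    rw [eq_sub_iff_add_eq, ← Finset.sum_union]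
    · congr 1
      ext p
      simp only [Finset.mem_union, mem_primesIoc, Nat.cast_le]
      constructor
      · rintro (⟨hp, -, h⟩ | ⟨hp, h0, h⟩)
        · exact ⟨hp, hp.pos, h⟩
        · exact ⟨hp, h0, le_trans (by exact_mod_cast h) hy⟩
      · rintro ⟨hp, h0, h⟩
        rcases lt_or_ge D p with h' | h'
        · exact Or.inl ⟨hp, h', h⟩
        · exact Or.inr ⟨hp, h0, h'⟩
    · rw [Finset.disjoint_left]
      intro p hp hp'
      have h1 := (mem_primesIoc.1 hp).2.1
      have h2 := (mem_primesIoc.1 hp').2.2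
      rw [Nat.cast_le] at h2
      omega
  have hχ1 : ∀ n : ℕ, ‖χ (n : ZMod D)‖ ≤ 1 := fun n => DirichletCharacter.norm_le_one χ _
  -- For `Re s > 9 / 8` the sums converge absolutely; otherwise the shifted points stay in the range
  -- `Re s ≤ 5 / 4`.
  rcases le_or_gt s.re (9 / 8) with hσ | hσ
  · have hy1 := hC₁ (fun n => χ n) hχ1 y (by linarith) (by linarith) s hs
    have hD1 := hC₁ (fun n => χ n) hχ1 D (by linarith) hlD s hs
    set ε : ℝ := 1 / 8 / Real.log y with hε
    set η : ℝ := 1 / 8 / Real.log D with hη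
    have hε0 : 0 < ε := by
      have : 0 < Real.log y := by linarith
      positivity
    have hεη : ε ≤ η := by
      rw [hε, hη]
      gcongr
    have hη8 : η ≤ 1 / 8 := div_le_self (by norm_num) hlD
    have hηD : η ≤ 1 / Real.log D := by
      rw [hη]
      gcongr
      norm_num
    have hre : ∀ r : ℝ, (s + (r : ℂ)).re = s.re + r := fun r => by simp
    have him : ∀ r : ℝ, (s + (r : ℂ)).im = s.im := fun r => by simp
    have hLy := (hC₂ D χ (s + (ε : ℂ)) (by rw [hre]; linarith)).2
    have hLD := (hC₂ D χ (s + (η : ℂ)) (by rw [hre]; linarith)).2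
    have hL := hC₃ D hlD χ hχ (s + (ε : ℂ)) (s + (η : ℂ)) (by rw [him, him]) (by rwa [him])
      (by rw [hre]; linarith) (by rw [hre, hre]; linarith) (by rw [hre]; linarith)
      (by rw [hre, hre]; linarith)
    have hy2 := (abs_le.1 ((Complex.abs_re_le_norm _).trans hy1)).2
    have hD2 := (abs_le.1 ((Complex.abs_re_le_norm _).trans hD1)).1
    rw [Complex.sub_re] at hy2 hD2
    rw [hsub, Complex.sub_re]
    linarith [(abs_le.1 hLy).2, (abs_le.1 hLD).1, le_abs_self C₂]
  · have htriv : ∀ z : ℝ, ‖∑ p ∈ primesIoc 0 z, χ (p : ZMod D) * (p : ℂ) ^ (-s)‖ ≤ P := by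
      intro z
      rw [← (hasSum_ite_primesIoc z fun p => χ (p : ZMod D) * (p : ℂ) ^ (-s)).tsum_eq]
      refine tsum_of_norm_bounded hPs.hasSum fun p => ?_
      split_ifs
      · rw [norm_mul, Complex.norm_natCast_cpow_of_pos p.2.pos, Complex.neg_re]
        have hp1 : (1 : ℝ) ≤ ((p : ℕ) : ℝ) := by exact_mod_cast p.2.one_lt.le
        calc _ ≤ 1 * ((p : ℕ) : ℝ) ^ (-(9 / 8) : ℝ) := by
              gcongr
              exact hχ1 p
          _ = _ := one_mul _
      · rw [norm_zero]
        positivity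
    rw [hsub, Complex.sub_re]
    have h1 := (abs_le.1 ((Complex.abs_re_le_norm _).trans (htriv y))).2
    have h2 := (abs_le.1 ((Complex.abs_re_le_norm _).trans (htriv D))).1
    linarith [abs_nonneg C₂]

end DirichletCharacter

/-! ### Duality and the large sieve -/

section LargeSieve

variable {ι : Type*} [Fintype ι]

/-- For nonnegative coefficients only upper bounds on the real parts of the off-diagonal inner
products matter. -/
theorem sum_mul_norm_sum_ofReal_mul_sq_le (P : Finset ℕ) (w : ℕ → ℝ) (φ : ι → ℕ → ℂ) {L C : ℝ}
    (hC : 0 ≤ C) (hdiag : ∀ j, ∑ p ∈ P, w p * ‖φ j p‖ ^ 2 ≤ L)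
    (hoff : ∀ j l, j ≠ l → (∑ p ∈ P, (w p : ℂ) * (φ j p * star (φ l p))).re ≤ C)
    (u : ι → ℝ) (hu : ∀ j, 0 ≤ u j) :
    ∑ p ∈ P, w p * ‖∑ j, (u j : ℂ) * φ j p‖ ^ 2
      ≤ (L + ((Fintype.card ι : ℝ) - 1) * C) * ∑ j, u j ^ 2 := by
  classical
  have hexp : ∑ p ∈ P, w p * ‖∑ j, (u j : ℂ) * φ j p‖ ^ 2
      = ∑ j, ∑ l, u j * u l * (∑ p ∈ P, (w p : ℂ) * (φ j p * star (φ l p))).re := by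
    have h1 : ∀ p, w p * ‖∑ j, (u j : ℂ) * φ j p‖ ^ 2
        = ∑ j, ∑ l, u j * u l * ((w p : ℂ) * (φ j p * star (φ l p))).re := by
      intro p
      have h2 : ((‖∑ j, (u j : ℂ) * φ j p‖ ^ 2 : ℝ) : ℂ)
          = ∑ j, ∑ l, ((u j * u l : ℝ) : ℂ) * (φ j p * star (φ l p)) := by
        push_cast
        rw [← Complex.mul_conj', map_sum, Finset.sum_mul_sum]
        refine Finset.sum_congr rfl fun j _ => Finset.sum_congr rfl fun l _ => ?_
        rw [map_mul, Complex.conj_ofReal, Complex.star_def]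
        ring
      have h3 := congrArg Complex.re h2
      rw [Complex.ofReal_re, Complex.re_sum] at h3
      rw [h3, Finset.mul_sum]
      refine Finset.sum_congr rfl fun j _ => ?_
      rw [Complex.re_sum, Finset.mul_sum]
      refine Finset.sum_congr rfl fun l _ => ?_
      rw [Complex.re_ofReal_mul, Complex.re_ofReal_mul]
      ring
    simp_rw [h1]
    rw [Finset.sum_comm]
    refine Finset.sum_congr rfl fun j _ => ?_
    rw [Finset.sum_comm]
    refine Finset.sum_congr rfl fun l _ => ?_
    rw [Complex.re_sum, Finset.mul_sum]
  -- The diagonal is over-counted by `C` and corrected by `L - C`.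
  have hterm : ∀ j l, u j * u l * (∑ p ∈ P, (w p : ℂ) * (φ j p * star (φ l p))).re
      ≤ C * (u j * u l) + if j = l then (L - C) * u j ^ 2 else 0 := by
    intro j l
    split_ifs with h
    · subst h
      have hre : (∑ p ∈ P, (w p : ℂ) * (φ j p * star (φ j p))).re
          = ∑ p ∈ P, w p * ‖φ j p‖ ^ 2 := by
        rw [Complex.re_sum]
        refine Finset.sum_congr rfl fun p _ => ?_
        rw [Complex.re_ofReal_mul, Complex.star_def, Complex.mul_conj', ← Complex.ofReal_pow,
          Complex.ofReal_re]
      rw [hre]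
      nlinarith [mul_le_mul_of_nonneg_left (hdiag j) (sq_nonneg (u j))]
    · nlinarith [mul_le_mul_of_nonneg_left (hoff j l h) (mul_nonneg (hu j) (hu l))]
  have hcs : (∑ j, u j) ^ 2 ≤ (Fintype.card ι : ℝ) * ∑ j, u j ^ 2 := by
    simpa using sq_sum_le_card_mul_sum_sq (s := Finset.univ) (f := u)
  calc _ = ∑ j, ∑ l, u j * u l * (∑ p ∈ P, (w p : ℂ) * (φ j p * star (φ l p))).re := hexp
    _ ≤ ∑ j, ∑ l, (C * (u j * u l) + if j = l then (L - C) * u j ^ 2 else 0) :=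
        Finset.sum_le_sum fun j _ => Finset.sum_le_sum fun l _ => hterm j l
    _ = C * (∑ j, u j) ^ 2 + (L - C) * ∑ j, u j ^ 2 := by
        simp_rw [Finset.sum_add_distrib, ← Finset.mul_sum]
        rw [sq, Finset.sum_mul_sum]
        simp [Finset.mul_sum]
    _ ≤ C * ((Fintype.card ι : ℝ) * ∑ j, u j ^ 2) + (L - C) * ∑ j, u j ^ 2 := by gcongr
    _ = _ := by ring

theorem norm_sub_add_mul_I_sq_le (a b c d : ℂ) :
    ‖a - b + (c - d) * Complex.I‖ ^ 2 ≤ 4 * (‖a‖ ^ 2 + ‖b‖ ^ 2 + ‖c‖ ^ 2 + ‖d‖ ^ 2) := by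
  have h : ‖a - b + (c - d) * Complex.I‖ ≤ ‖a‖ + ‖b‖ + ‖c‖ + ‖d‖ := by
    calc _ ≤ ‖a - b‖ + ‖(c - d) * Complex.I‖ := norm_add_le _ _
      _ = ‖a - b‖ + ‖c - d‖ := by rw [norm_mul, Complex.norm_I, mul_one]
      _ ≤ (‖a‖ + ‖b‖) + (‖c‖ + ‖d‖) := add_le_add (norm_sub_le _ _) (norm_sub_le _ _)
      _ = _ := by ring
  calc _ ≤ (‖a‖ + ‖b‖ + ‖c‖ + ‖d‖) ^ 2 := by gcongr
    _ ≤ _ := by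
      nlinarith [sq_nonneg (‖a‖ - ‖b‖), sq_nonneg (‖a‖ - ‖c‖), sq_nonneg (‖a‖ - ‖d‖),
        sq_nonneg (‖b‖ - ‖c‖), sq_nonneg (‖b‖ - ‖d‖), sq_nonneg (‖c‖ - ‖d‖)]

/-- Arbitrary complex coefficients are split into four nonnegative ones, which costs a
factor `4`. -/
theorem sum_mul_norm_sum_mul_sq_le (P : Finset ℕ) (w : ℕ → ℝ) (hw : ∀ p ∈ P, 0 ≤ w p)
    (φ : ι → ℕ → ℂ) {L C : ℝ}
    (hC : 0 ≤ C) (hdiag : ∀ j, ∑ p ∈ P, w p * ‖φ j p‖ ^ 2 ≤ L)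
    (hoff : ∀ j l, j ≠ l → (∑ p ∈ P, (w p : ℂ) * (φ j p * star (φ l p))).re ≤ C)
    (z : ι → ℂ) :
    ∑ p ∈ P, w p * ‖∑ j, z j * φ j p‖ ^ 2
      ≤ 4 * (L + ((Fintype.card ι : ℝ) - 1) * C) * ∑ j, ‖z j‖ ^ 2 := by
  have key := sum_mul_norm_sum_ofReal_mul_sq_le P w φ hC hdiag hoff
  have h1 := key (fun j => (z j).re⁺) fun j => posPart_nonneg _
  have h2 := key (fun j => (z j).re⁻) fun j => negPart_nonneg _
  have h3 := key (fun j => (z j).im⁺) fun j => posPart_nonneg _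
  have h4 := key (fun j => (z j).im⁻) fun j => negPart_nonneg _
  have hz : ∀ j, z j = (((z j).re⁺ : ℝ) : ℂ) - (((z j).re⁻ : ℝ) : ℂ)
      + ((((z j).im⁺ : ℝ) : ℂ) - (((z j).im⁻ : ℝ) : ℂ)) * Complex.I := by
    intro j
    rw [← Complex.ofReal_sub, ← Complex.ofReal_sub, posPart_sub_negPart, posPart_sub_negPart,
      Complex.re_add_im]
  have hsq : ∀ r : ℝ, r⁺ ^ 2 + r⁻ ^ 2 = r ^ 2 := by
    intro r
    rcases le_total 0 r with h | h
    · rw [posPart_eq_self.2 h, negPart_eq_zero.2 h]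
      ring
    · rw [posPart_eq_zero.2 h, negPart_eq_neg.2 h]
      ring
  have hn : ∑ j, ‖z j‖ ^ 2 = ∑ j, (z j).re⁺ ^ 2 + ∑ j, (z j).re⁻ ^ 2
      + (∑ j, (z j).im⁺ ^ 2 + ∑ j, (z j).im⁻ ^ 2) := by
    rw [← Finset.sum_add_distrib, ← Finset.sum_add_distrib, ← Finset.sum_add_distrib]
    refine Finset.sum_congr rfl fun j _ => ?_
    rw [hsq, hsq, Complex.sq_norm, Complex.normSq_apply]
    ring
  have hp : ∀ p, ∑ j, z j * φ j p
      = ∑ j, (((z j).re⁺ : ℝ) : ℂ) * φ j p - ∑ j, (((z j).re⁻ : ℝ) : ℂ) * φ j p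
        + (∑ j, (((z j).im⁺ : ℝ) : ℂ) * φ j p - ∑ j, (((z j).im⁻ : ℝ) : ℂ) * φ j p) * Complex.I := by
    intro p
    rw [← Finset.sum_sub_distrib, ← Finset.sum_sub_distrib, Finset.sum_mul,
      ← Finset.sum_add_distrib]
    refine Finset.sum_congr rfl fun j _ => ?_
    conv_lhs => rw [hz j]
    ring
  calc ∑ p ∈ P, w p * ‖∑ j, z j * φ j p‖ ^ 2
      ≤ ∑ p ∈ P, 4 * (w p * ‖∑ j, (((z j).re⁺ : ℝ) : ℂ) * φ j p‖ ^ 2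
        + w p * ‖∑ j, (((z j).re⁻ : ℝ) : ℂ) * φ j p‖ ^ 2
        + w p * ‖∑ j, (((z j).im⁺ : ℝ) : ℂ) * φ j p‖ ^ 2
        + w p * ‖∑ j, (((z j).im⁻ : ℝ) : ℂ) * φ j p‖ ^ 2) := by
        refine Finset.sum_le_sum fun p hpP => ?_
        rw [hp]
        refine (mul_le_mul_of_nonneg_left (norm_sub_add_mul_I_sq_le _ _ _ _)
          (hw p hpP)).trans (le_of_eq ?_)
        ring
    _ ≤ _ := by
        rw [← Finset.mul_sum, Finset.sum_add_distrib, Finset.sum_add_distrib,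
          Finset.sum_add_distrib, hn]
        linarith

/-- The dual inequality: a quadratic form bound for the columns gives the same bound for
the rows. -/
theorem sum_norm_sum_mul_sq_le_of_dual (P : Finset ℕ) (w : ℕ → ℝ) (hw : ∀ p ∈ P, 0 < w p)
    (φ : ι → ℕ → ℂ) {Λ : ℝ} (hΛ : 0 ≤ Λ)
    (hdual : ∀ z : ι → ℂ, ∑ p ∈ P, w p * ‖∑ j, z j * φ j p‖ ^ 2 ≤ Λ * ∑ j, ‖z j‖ ^ 2)
    (a : ℕ → ℂ) :
    ∑ j, ‖∑ p ∈ P, a p * φ j p‖ ^ 2 ≤ Λ * ∑ p ∈ P, ‖a p‖ ^ 2 / w p := by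
  set S : ι → ℂ := fun j => ∑ p ∈ P, a p * φ j p with hS
  set T : ℝ := ∑ j, ‖S j‖ ^ 2 with hT
  set A : ℝ := ∑ p ∈ P, ‖a p‖ ^ 2 / w p with hA
  have hA0 : 0 ≤ A := Finset.sum_nonneg fun p hp => by
    have := hw p hp
    positivity
  have hT0 : 0 ≤ T := Finset.sum_nonneg fun j _ => by positivity
  have hd := hdual fun j => star (S j)
  simp only [norm_star] at hd
  have hTeq : (T : ℂ) = ∑ p ∈ P, a p * ∑ j, star (S j) * φ j p := by
    rw [hT]
    push_cast
    simp_rw [Finset.mul_sum]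
    rw [Finset.sum_comm]
    refine Finset.sum_congr rfl fun j _ => ?_
    rw [← Complex.conj_mul', ← Complex.star_def]
    conv_lhs => rw [hS]
    simp only [Finset.mul_sum]
    refine Finset.sum_congr rfl fun p _ => ?_
    ring
  have hTle : T ≤ ∑ p ∈ P, ‖a p‖ * ‖∑ j, star (S j) * φ j p‖ := by
    calc T = ‖(T : ℂ)‖ := by rw [Complex.norm_real, Real.norm_of_nonneg hT0]
      _ ≤ _ := by
        rw [hTeq]
        refine (norm_sum_le _ _).trans (le_of_eq ?_)
        simp_rw [norm_mul]
  have hcs : (∑ p ∈ P, ‖a p‖ * ‖∑ j, star (S j) * φ j p‖) ^ 2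
      ≤ A * ∑ p ∈ P, w p * ‖∑ j, star (S j) * φ j p‖ ^ 2 := by
    refine Finset.sum_sq_le_sum_mul_sum_of_sq_le_mul P ?_ ?_ ?_
    · intro p hp
      have := hw p hp
      positivity
    · intro p hp
      have := hw p hp
      positivity
    · intro p hp
      have := (hw p hp).ne'
      refine le_of_eq ?_
      field_simp
  have hTT : T * T ≤ Λ * A * T := by
    calc T * T = T ^ 2 := (sq T).symm
      _ ≤ (∑ p ∈ P, ‖a p‖ * ‖∑ j, star (S j) * φ j p‖) ^ 2 := by gcongr
      _ ≤ A * (Λ * T) := hcs.trans (by gcongr)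
      _ = _ := by ring
  rcases hT0.eq_or_lt with h | h
  · rw [← h]
    positivity
  · exact le_of_mul_le_mul_right hTT h

end LargeSieve

/-! ### Attainment of the maxima -/

section Maxima

theorem continuous_primeSum {D : ℕ} (a : ℕ → ℂ) (χ : DirichletCharacter ℂ D) (y : ℝ) :
    Continuous (primeSum a χ y) := by
  unfold primeSum
  refine continuous_finsetSum _ fun p hp => continuous_const.mul ?_
  have hp0 : (p : ℂ) ≠ 0 := by exact_mod_cast (mem_primesIoc.1 hp).1.ne_zero
  exact continuous_neg.const_cpow (Or.inl hp0)

theorem norm_primeSum_le {D : ℕ} (a : ℕ → ℂ) (χ : DirichletCharacter ℂ D) (y : ℝ) {s : ℂ}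
    (hs : 0 ≤ s.re) :
    ‖primeSum a χ y s‖ ≤ (∑ p ∈ primesIoc D y, ‖a p‖) * (2 : ℝ) ^ (-s.re) := by
  rw [primeSum, Finset.sum_mul]
  refine (norm_sum_le _ _).trans (Finset.sum_le_sum fun p hp => ?_)
  have hpp := (mem_primesIoc.1 hp).1
  have hp2 : (2 : ℝ) ≤ p := by exact_mod_cast hpp.two_le
  rw [norm_mul, norm_mul, Complex.norm_natCast_cpow_of_pos hpp.pos, Complex.neg_re]
  calc ‖a p‖ * ‖χ (p : ZMod D)‖ * (p : ℝ) ^ (-s.re) ≤ ‖a p‖ * 1 * (2 : ℝ) ^ (-s.re) := by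
        refine mul_le_mul (mul_le_mul_of_nonneg_left (DirichletCharacter.norm_le_one χ _)
          (norm_nonneg _)) ?_ (by positivity) (by positivity)
        exact Real.rpow_le_rpow_of_nonpos (by norm_num) hp2 (by linarith)
    _ = _ := by ring

/-- The maximum over the unbounded half-strip is attained, because the sum decays as
`Re s → ∞`. -/
theorem exists_isGreatest_norm_primeSum_sq {D : ℕ} (a : ℕ → ℂ) (χ : DirichletCharacter ℂ D)
    (y : ℝ) {T : ℝ} (hT : 0 ≤ T) :
    ∃ v, IsGreatest ((fun s : ℂ => ‖primeSum a χ y s‖ ^ 2) '' halfStrip T) v := by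
  set f : ℂ → ℝ := fun s => ‖primeSum a χ y s‖ ^ 2 with hf
  have hfc : Continuous f := (continuous_primeSum a χ y).norm.pow 2
  have h1 : (1 : ℂ) ∈ halfStrip T := ⟨by simp, by simpa using hT⟩
  by_cases hzero : ∀ s ∈ halfStrip T, f s = 0
  · refine ⟨0, ⟨1, h1, hzero 1 h1⟩, ?_⟩
    rintro _ ⟨s, hs, rfl⟩
    exact (hzero s hs).le
  push Not at hzero
  obtain ⟨s₀, hs₀, hne⟩ := hzero
  have hpos : 0 < f s₀ := lt_of_le_of_ne (sq_nonneg _) (Ne.symm hne)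
  set A := ∑ p ∈ primesIoc D y, ‖a p‖ with hA
  have hlim : Filter.Tendsto (fun σ : ℝ => (A * (2 : ℝ) ^ (-σ)) ^ 2) Filter.atTop (nhds 0) := by
    have h2 : Filter.Tendsto (fun σ : ℝ => (2 : ℝ) ^ (-σ)) Filter.atTop (nhds 0) :=
      (tendsto_rpow_atBot_of_base_gt_one 2 (by norm_num)).comp Filter.tendsto_neg_atTop_atBot
    simpa using (h2.const_mul A).pow 2
  obtain ⟨σ₀, hσ₀⟩ := Filter.eventually_atTop.1 (hlim.eventually_lt_const hpos)
  set σ₁ := max σ₀ s₀.re with hσ₁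
  have hK : IsCompact (Set.Icc 1 σ₁ ×ℂ Set.Icc (-T) T) := isCompact_Icc.reProdIm isCompact_Icc
  have hs₀K : s₀ ∈ Set.Icc 1 σ₁ ×ℂ Set.Icc (-T) T :=
    ⟨⟨hs₀.1, le_max_right _ _⟩, abs_le.1 hs₀.2⟩
  obtain ⟨s₁, hs₁, hmax⟩ := hK.exists_isMaxOn ⟨s₀, hs₀K⟩ hfc.continuousOn
  refine ⟨f s₁, ⟨s₁, ⟨hs₁.1.1, abs_le.2 hs₁.2⟩, rfl⟩, ?_⟩
  rintro _ ⟨s, hs, rfl⟩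
  rcases le_or_gt s.re σ₁ with h | h
  · exact hmax (show s ∈ Set.Icc 1 σ₁ ×ℂ Set.Icc (-T) T from ⟨⟨hs.1, h⟩, abs_le.1 hs.2⟩)
  · have hle : f s ≤ (A * (2 : ℝ) ^ (-s.re)) ^ 2 := by
      have := norm_primeSum_le a χ y (s := s) (by linarith [hs.1])
      simp only [hf]
      gcongr
    exact (hle.trans (hσ₀ s.re ((le_max_left _ _).trans h.le)).le).trans (hmax hs₀K)

theorem primesIoc_natFloor (D : ℕ) (y : ℝ) : primesIoc D (⌊y⌋₊ : ℝ) = primesIoc D y := by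
  rw [primesIoc, primesIoc, Nat.floor_natCast]

end Maxima

/-! ### The maximal inequality -/

theorem filter_primesIoc_le {D : ℕ} {x y : ℝ} (hy : y ≤ x) :
    (primesIoc D x).filter (fun p : ℕ => (p : ℝ) ≤ y) = primesIoc D y := by
  ext p
  simp only [Finset.mem_filter, mem_primesIoc]
  constructor
  · rintro ⟨⟨h1, h2, -⟩, h3⟩
    exact ⟨h1, h2, h3⟩
  · rintro ⟨h1, h2, h3⟩
    exact ⟨⟨h1, h2, h3.trans hy⟩, h3⟩

/-- The inner product of two twisted prime sums is a prime sum twisted by the quotient of the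
characters. -/
theorem natCast_mul_char_cpow_mul_star {D : ℕ} [NeZero D] (χ ψ : DirichletCharacter ℂ D)
    {p : ℕ} (hp : p.Prime) (s t : ℂ) :
    ((p : ℝ) : ℂ) * ((χ (p : ZMod D) * (p : ℂ) ^ (-s)) * star (ψ (p : ZMod D) * (p : ℂ) ^ (-t)))
      = (χ * ψ⁻¹) (p : ZMod D) * (p : ℂ) ^ (-(s + star t - 1)) := by
  have hp0 : (p : ℂ) ≠ 0 := by exact_mod_cast hp.ne_zero
  have hconj : star ((p : ℂ) ^ (-t)) = (p : ℂ) ^ (-star t) := by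
    have h := Complex.conj_cpow (p : ℂ) (-star t)
      (by rw [Complex.natCast_arg]; exact Real.pi_pos.ne)
    rw [Complex.conj_natCast] at h
    rw [h, map_neg, Complex.star_def, Complex.conj_conj]
  rw [star_mul', MulChar.star_apply', hconj, MulChar.mul_apply,
    show -(s + star t - 1) = -s + -star t + 1 by ring, Complex.cpow_add _ _ hp0,
    Complex.cpow_add _ _ hp0, Complex.cpow_one]
  push_cast
  ring

/-- The inequality for fixed truncation points and fixed points of the half-strip. -/
theorem exists_sum_norm_primeSum_sq_le {B : ℝ} (hB : 0 < B) :
    ∃ c : ℝ, ∀ (D : ℕ), 1 ≤ D → ∀ (x : ℝ) (k : ℕ), 1 ≤ k →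
      ∀ χ : Fin k → DirichletCharacter ℂ D, Function.Injective χ → ∀ (a : ℕ → ℂ)
        (y : Fin k → ℝ) (s : Fin k → ℂ), (∀ j, y j ≤ x) →
        (∀ j, s j ∈ halfStrip ((D : ℝ) ^ B)) →
        ∑ j, ‖primeSum a (χ j) (y j) (s j)‖ ^ 2 ≤
          (4 * (∑ p ∈ primesIoc D x, (1 : ℝ) / p) + ((k : ℝ) - 1) * c) *
            ∑ p ∈ primesIoc D x, ‖a p‖ ^ 2 / (p : ℝ) := by
  obtain ⟨C, hC0, hC⟩ := DirichletCharacter.exists_re_sum_primesIoc_le hB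
  refine ⟨4 * C, fun D hD x k hk χ hχ a y s hy hs => ?_⟩
  have : NeZero D := ⟨by omega⟩
  set P := primesIoc D x with hP
  set L : ℝ := ∑ p ∈ P, (1 : ℝ) / p with hL
  set φ : Fin k → ℕ → ℂ := fun j p =>
    if (p : ℝ) ≤ y j then χ j (p : ZMod D) * (p : ℂ) ^ (-s j) else 0 with hφ
  have hsum : ∀ j, ∑ p ∈ P, a p * φ j p = primeSum a (χ j) (y j) (s j) := by
    intro j
    rw [primeSum, ← filter_primesIoc_le (hy j), Finset.sum_filter]
    refine Finset.sum_congr rfl fun p _ => ?_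
    simp only [hφ]
    split_ifs
    · ring
    · ring
  have hdiag : ∀ j, ∑ p ∈ P, (p : ℝ) * ‖φ j p‖ ^ 2 ≤ L := by
    intro j
    refine Finset.sum_le_sum fun p hp => ?_
    have hpp := (mem_primesIoc.1 hp).1
    have hp0 : (0 : ℝ) < p := by exact_mod_cast hpp.pos
    have hp1 : (1 : ℝ) ≤ p := by exact_mod_cast hpp.one_lt.le
    have hn : ‖φ j p‖ ≤ (p : ℝ)⁻¹ := by
      simp only [hφ]
      split_ifs
      · rw [norm_mul, Complex.norm_natCast_cpow_of_pos hpp.pos, Complex.neg_re]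
        calc _ ≤ 1 * (p : ℝ) ^ (-1 : ℝ) := by
              gcongr
              · exact DirichletCharacter.norm_le_one _ _
              · exact (hs j).1
          _ = _ := by rw [one_mul, Real.rpow_neg_one]
      · rw [norm_zero]
        positivity
    calc (p : ℝ) * ‖φ j p‖ ^ 2 ≤ (p : ℝ) * ((p : ℝ)⁻¹) ^ 2 := by gcongr
      _ = 1 / (p : ℝ) := by field_simp
  have hoff : ∀ j l, j ≠ l →
      (∑ p ∈ P, ((p : ℝ) : ℂ) * (φ j p * star (φ l p))).re ≤ C := by
    intro j l hjl
    have heq : ∑ p ∈ P, ((p : ℝ) : ℂ) * (φ j p * star (φ l p))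
        = ∑ p ∈ primesIoc D (min (y j) (y l)),
          (χ j * (χ l)⁻¹) (p : ZMod D) * (p : ℂ) ^ (-(s j + star (s l) - 1)) := by
      rw [← filter_primesIoc_le ((min_le_left _ _).trans (hy j)), Finset.sum_filter]
      refine Finset.sum_congr rfl fun p hp => ?_
      rw [← natCast_mul_char_cpow_mul_star _ _ (mem_primesIoc.1 hp).1]
      simp only [hφ, le_min_iff]
      by_cases h1 : (p : ℝ) ≤ y j <;> by_cases h2 : (p : ℝ) ≤ y l <;> simp [h1, h2]
    rw [heq]
    refine hC D hD _ (fun h => hjl (hχ (mul_inv_eq_one.1 h))) _ _ ?_ ?_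
    · have h1 := (hs j).1
      have h2 := (hs l).1
      simp only [Complex.sub_re, Complex.add_re, Complex.star_def, Complex.conj_re,
        Complex.one_re]
      linarith
    · have h1 := (hs j).2
      have h2 := (hs l).2
      simp only [Complex.sub_im, Complex.add_im, Complex.star_def, Complex.conj_im,
        Complex.one_im, sub_zero, ← sub_eq_add_neg]
      linarith [abs_sub (s j).im (s l).im]
  have hk1 : (1 : ℝ) ≤ k := by exact_mod_cast hk
  have hL0 : 0 ≤ L := Finset.sum_nonneg fun p _ => by positivity
  have hw : ∀ p ∈ P, (0 : ℝ) < (p : ℝ) := fun p hp => by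
    exact_mod_cast (mem_primesIoc.1 hp).1.pos
  have hdual := sum_mul_norm_sum_mul_sq_le P (fun p => (p : ℝ)) (fun p hp => (hw p hp).le) φ hC0
    hdiag hoff
  have hmain := sum_norm_sum_mul_sq_le_of_dual P (fun p => (p : ℝ)) hw φ
    (by
      rw [Fintype.card_fin]
      have : 0 ≤ ((k : ℝ) - 1) * C := mul_nonneg (by linarith) hC0
      linarith) hdual a
  simp only [hsum, Fintype.card_fin] at hmain
  refine hmain.trans (le_of_eq ?_)
  ring

/-- `N j y` is the inner maximum, over `s`, and `M j` is the outer maximum, over `y ≤ x`; that both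
maxima are attained is part of the conclusion. -/
theorem mainTheorem1 (B : ℝ) (hB : 0 < B) :
    ∃ c : ℝ, ∀ (D : ℕ), 1 ≤ D → ∀ (x : ℝ), (D : ℝ) ≤ x →
      ∀ (k : ℕ), 1 ≤ k → ∀ (χ : Fin k → DirichletCharacter ℂ D), Function.Injective χ →
      ∀ (a : ℕ → ℂ),
      ∃ (N : Fin k → ℝ → ℝ) (M : Fin k → ℝ),
        (∀ j, ∀ y ≤ x, IsGreatest
          ((fun s : ℂ => ‖primeSum a (χ j) y s‖ ^ 2) '' halfStrip ((D : ℝ) ^ B)) (N j y)) ∧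
        (∀ j, IsGreatest (N j '' Set.Iic x) (M j)) ∧
        ∑ j, M j ≤
          (4 * (∑ p ∈ primesIoc D x, (1 : ℝ) / p) + ((k : ℝ) - 1) * c) *
            ∑ p ∈ primesIoc D x, ‖a p‖ ^ 2 / (p : ℝ) := by
  obtain ⟨c, hc⟩ := exists_sum_norm_primeSum_sq_le hB
  refine ⟨c, fun D hD x _ k hk χ hχ a => ?_⟩
  have hT : 0 ≤ (D : ℝ) ^ B := by positivity
  choose N hN using fun (j : Fin k) (y : ℝ) =>
    exists_isGreatest_norm_primeSum_sq a (χ j) y hT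
  -- Only finitely many truncations `y ≤ x` differ, since the sum depends on `⌊y⌋₊` alone.
  have hfloor : ∀ j y, N j y = N j (⌊y⌋₊ : ℝ) := by
    intro j y
    refine (hN j y).unique ?_
    have h := hN j (⌊y⌋₊ : ℝ)
    simp only [primeSum, primesIoc_natFloor] at h
    simpa only [primeSum] using h
  have hfin : ∀ j, (N j '' Set.Iic x).Finite := by
    intro j
    refine ((Set.finite_Iic ⌊x⌋₊).image fun n : ℕ => N j n).subset ?_
    rintro _ ⟨y, hy, rfl⟩
    exact ⟨⌊y⌋₊, Nat.floor_mono hy, (hfloor j y).symm⟩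
  have hmax : ∀ j, ∃ y ≤ x, IsGreatest (N j '' Set.Iic x) (N j y) := by
    intro j
    obtain ⟨y, hy, hyM⟩ := (Set.nonempty_Iic.image (N j)).csSup_mem (hfin j)
    refine ⟨y, hy, ⟨y, hy, rfl⟩, fun v hv => ?_⟩
    rw [hyM]
    exact le_csSup (hfin j).bddAbove hv
  choose y hyx hy using hmax
  choose s hs hsN using fun j => (hN j (y j)).1
  refine ⟨N, fun j => N j (y j), fun j z _ => hN j z, hy, ?_⟩
  have h := hc D hD x k hk χ hχ a y s hyx hs
  refine le_trans (le_of_eq (Finset.sum_congr rfl fun j _ => ?_)) h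
  exact (hsN j).symm
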